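/- Let $\tau\in\mathbb C$ with $\operatorname{Im}\tau>0$ and $h\in\mathbb C$. Let $\mathfrak h^*=\mathbb C\varepsilon_1\oplus\mathbb C\varepsilon_2$ with the bilinear form $(\varepsilon_j,\varepsilon_k)=\tfrac12\delta_{jk}$, let $W$ be the Weyl group generated by the reflections in the roots $\pm(\varepsilon_1\pm\varepsilon_2),\pm2\varepsilon_1,\pm2\varepsilon_2$ of type $C_2$, and let $Q^\vee=\mathbb Z2\varepsilon_1+\mathbb Z2\varepsilon_2$. Let $$\theta_1(z)=\sum_{k\in\mathbb Z}e^{2\pi i\left((z+\frac12)(k+\frac12)+\frac12(k+\frac12)^2\tau\right)},\qquad \theta_2(z)=\sum_{k\in\mathbb Z}e^{2\pi i\left(z(k+\frac12)+\frac12(k+\frac12)^2\tau\right)},$$ $$\theta_3(z)=\sum_{k\in\mathbb Z}e^{2\pi i\left(zk+\frac{k^2}2\tau\right)},\qquad \theta_4(z)=\sum_{k\in\mathbb Z}e^{2\pi i\left((z+\frac12)k+\frac{k^2}2\tau\right)},$$ and, for $\mu\in\mathbb Z\varepsilon_1+\mathbb Z\varepsilon_2$, $\Theta_\mu(\lambda)=\sum_{\gamma\in\mu+Q^\vee}e^{2\pi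 i\left((\gamma,\lambda)+\frac{(\gamma,\gamma)}2\tau\right)}$. Let $Th_1^W$ be the space of holomorphic functions $f$ on $\mathfrak h^*$ with $f(\lambda+\alpha)=f(\lambda)$ and $e^{2\pi i\left((\lambda,\alpha)+\frac{(\alpha,\alpha)}2\tau\right)}f(\lambda+\tau\alpha)=f(\lambda)$ for all $\alpha\in Q^\vee$, and $f(w\lambda)=f(\lambda)$ for all $w\in W$. With $\mathcal P_1=\{\pm\varepsilon_1,\pm\varepsilon_2\}$ and $\lambda_p=(\lambda,p)$, define the difference operators $$(\widetilde M_1f)(\lambda)=\sum_{p\in\mathcal P_1}\ \prod_{q\in\mathcal P_1,\,q\ne\pm p}\frac{\theta_1(\lambda_{p+q}-h)}{\theta_1(\lambda_{p+q})}\,f(\lambda+2hp),$$ $$(\widetilde M_2f)(\lambda)=\sum_{p=\pm\varepsilon_1,\ q=\pm\varepsilon_2}\left(\frac{\theta_1(\lambda_{p+q}-h)}{\theta_1(\lambda_{p+q}+h)}f(\lambda+2hp+2hq)+\frac{\theta_1(\lambda_{p+q}-h)\theta_1(\lambda_{p+q}+2h)}{\theta_1(\lambda_{p+q})\theta_1(\lambda_{p+q}+h)}f(\lambda)\right).$$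 Put $f_1=\Theta_{\varepsilon_1}+\Theta_{\varepsilon_2}$, $f_2=\Theta_0+\Theta_{\varepsilon_1+\varepsilon_2}$, $f_3=\Theta_0-\Theta_{\varepsilon_1+\varepsilon_2}$. Then $f_1,f_2,f_3$ lie in $Th_1^W$ and are linearly independent (in particular non-zero), and for every $i\in\{1,2,3\}$ such that $\theta_1(h)\ne0$ and $\theta_{i+1}(h)\ne0$, the function $f_i$ is a common eigenfunction of $\widetilde M_1$ and $\widetilde M_2$: $$\widetilde M_df_i=E_{d,i}f_i\quad(d=1,2),\qquad E_{1,i}=\left(\frac{\theta_1(2h)\,\theta_{i+1}(0)}{\theta_1(h)\,\theta_{i+1}(h)}\right)^2,\qquad E_{2,i}=2E_{1,i},$$ the equality holding at every $\lambda$ at which no denominator in the coefficients of $\widetilde M_d$ vanishes. -/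

import Mathlib

namespace C2

/-- The dual Cartan subalgebra of `sp(4, ℂ)`: the vector `x` is `x 0 • ε₁ + x 1 • ε₂`. -/
abbrev V : Type := Fin 2 → ℂ

/-- The weight `ε₁`. -/
def e1 : V := ![1, 0]

/-- The weight `ε₂`. -/
def e2 : V := ![0, 1]

/-- The normalized Killing form: the bilinear form with `(ε_j, ε_k) = δ_{jk} / 2`. -/
noncomputable def form (x y : V) : ℂ := (x 0 * y 0 + x 1 * y 1) / 2

/-- The roots `±(ε₁ ± ε₂), ±2ε₁, ±2ε₂`. -/
def roots : Set V :=
  {e1 + e2, -(e1 + e2), e1 - e2, -(e1 - e2),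
    (2 : ℂ) • e1, -((2 : ℂ) • e1), (2 : ℂ) • e2, -((2 : ℂ) • e2)}

/-- The Weyl group: generated by the reflections `x ↦ x - (2 (x, α) / (α, α)) α`, `α` a root. -/
def weylGroup : Subgroup (V ≃ₗ[ℂ] V) :=
  Subgroup.closure {s | ∃ a ∈ roots, ∀ x : V, s x = x - (2 * form x a / form a a) • a}

/-- The coroot lattice `ℤ 2ε₁ + ℤ 2ε₂`, coroots being identified with vectors by the form. -/
def corootLattice : AddSubgroup V :=
  AddSubgroup.closure {(2 : ℂ) • e1, (2 : ℂ) • e2}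

/-- The weights `±ε₁, ±ε₂` of the first fundamental representation. -/
noncomputable def P1 : Finset V := {e1, -e1, e2, -e2}

/-- The Jacobi theta function `θ₁(z | τ)`. -/
noncomputable def theta1 (τ z : ℂ) : ℂ :=
  ∑' k : ℤ, Complex.exp (2 * Real.pi * Complex.I *
    ((z + 1 / 2) * ((k : ℂ) + 1 / 2) + 1 / 2 * ((k : ℂ) + 1 / 2) ^ 2 * τ))

/-- The Jacobi theta function `θ₂(z | τ)`. -/
noncomputable def theta2 (τ z : ℂ) : ℂ :=
  ∑' k : ℤ, Complex.exp (2 * Real.pi * Complex.I *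
    (z * ((k : ℂ) + 1 / 2) + 1 / 2 * ((k : ℂ) + 1 / 2) ^ 2 * τ))

/-- The Jacobi theta function `θ₃(z | τ)`. -/
noncomputable def theta3 (τ z : ℂ) : ℂ :=
  ∑' k : ℤ, Complex.exp (2 * Real.pi * Complex.I * (z * (k : ℂ) + (k : ℂ) ^ 2 / 2 * τ))

/-- The Jacobi theta function `θ₄(z | τ)`. -/
noncomputable def theta4 (τ z : ℂ) : ℂ :=
  ∑' k : ℤ, Complex.exp (2 * Real.pi * Complex.I *
    ((z + 1 / 2) * (k : ℂ) + (k : ℂ) ^ 2 / 2 * τ))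

/-- The triple `θ₂, θ₃, θ₄`. -/
noncomputable def evenTheta (τ : ℂ) : Fin 3 → ℂ → ℂ := ![theta2 τ, theta3 τ, theta4 τ]

/-- The classical theta function `Θ_μ`, a sum over the coset `μ + Q^∨`. -/
noncomputable def Theta (τ : ℂ) (μ : V) (x : V) : ℂ :=
  ∑' b : corootLattice, Complex.exp (2 * Real.pi * Complex.I *
    (form (μ + (b : V)) x + form (μ + (b : V)) (μ + (b : V)) / 2 * τ))

/-- The translation `(T_β f)(x) = f (x + β)`. -/
def transl (b : V) (f : V → ℂ) : V → ℂ := fun x => f (x + b)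

/-- The operator `(T_{τβ} f)(x) = exp (2πi ((x, β) + (β, β) τ / 2)) f (x + τ β)`. -/
noncomputable def translTau (τ : ℂ) (b : V) (f : V → ℂ) : V → ℂ := fun x =>
  Complex.exp (2 * Real.pi * Complex.I * (form x b + form b b / 2 * τ)) * f (x + τ • b)

/-- The space of theta functions of level one. -/
def Th1 (τ : ℂ) : Set (V → ℂ) :=
  {f | Differentiable ℂ f ∧ ∀ a ∈ corootLattice, translTau τ a f = f ∧ transl a f = f}

/-- The Weyl-invariant theta functions of level one. -/
def Th1W (τ : ℂ) : Set (V → ℂ) :=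
  {f | f ∈ Th1 τ ∧ ∀ w ∈ weylGroup, ∀ x : V, f (w x) = f x}

/-- The difference operator `M̃₁`, with step `h`. -/
noncomputable def M1 (τ h : ℂ) (f : V → ℂ) (x : V) : ℂ :=
  ∑ p ∈ P1, (∏ q ∈ P1 with q ≠ p ∧ q ≠ -p,
    theta1 τ (form x (p + q) - h) / theta1 τ (form x (p + q))) *
      transl (h • (2 : ℂ) • p) f x

/-- The difference operator `M̃₂`, with step `h`. -/
noncomputable def M2 (τ h : ℂ) (f : V → ℂ) (x : V) : ℂ :=
  ∑ p ∈ ({e1, -e1} : Finset V), ∑ q ∈ ({e2, -e2} : Finset V),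
    (theta1 τ (form x (p + q) - h) / theta1 τ (form x (p + q) + h) *
        transl (h • (2 : ℂ) • p) (transl (h • (2 : ℂ) • q) f) x +
      theta1 τ (form x (p + q) - h) * theta1 τ (form x (p + q) + 2 * h) /
        (theta1 τ (form x (p + q)) * theta1 τ (form x (p + q) + h)) * f x)

/-- The points at which no denominator of the coefficients of `M̃₁` vanishes. -/
def regular1 (τ : ℂ) : Set V :=
  {x | ∀ p ∈ P1, ∀ q ∈ P1, q ≠ p → q ≠ -p → theta1 τ (form x (p + q)) ≠ 0}

/-- The points at which no denominator of the coefficients of `M̃₂` vanishes. -/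
def regular2 (τ h : ℂ) : Set V :=
  {x | ∀ p ∈ ({e1, -e1} : Finset V), ∀ q ∈ ({e2, -e2} : Finset V),
    theta1 τ (form x (p + q)) ≠ 0 ∧ theta1 τ (form x (p + q) + h) ≠ 0}

/-- The three functions `Θ_{ε₁} + Θ_{ε₂}`, `Θ_0 + Θ_{ε₁+ε₂}`, `Θ_0 - Θ_{ε₁+ε₂}`. -/
noncomputable def eigenfun (τ : ℂ) : Fin 3 → V → ℂ :=
  ![fun x => Theta τ e1 x + Theta τ e2 x,
    fun x => Theta τ 0 x + Theta τ (e1 + e2) x,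
    fun x => Theta τ 0 x - Theta τ (e1 + e2) x]

/-- The eigenvalue `(θ₁(2h) θ_{i+1}(0) / (θ₁(h) θ_{i+1}(h)))²`. -/
noncomputable def eigenval1 (τ h : ℂ) (i : Fin 3) : ℂ :=
  (theta1 τ (2 * h) * evenTheta τ i 0 / (theta1 τ h * evenTheta τ i h)) ^ 2

/-- The eigenvalue of `M̃₂`, twice that of `M̃₁`. -/
noncomputable def eigenval2 (τ h : ℂ) (i : Fin 3) : ℂ := 2 * eigenval1 τ h i

end C2

namespace C2

open Complex

/-! Put u = (λ, ε₁+ε₂) and v = (λ, ε₁-ε₂). The coroot lattice is orthogonal, so each Θ_μ is a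
product of θ₂ or θ₃ of modulus 2τ in the two coordinates; the addition formulas for modulus 2τ then
turn f_i into ϑ(u)ϑ(v) with ϑ = θ_{i+1} (`eigenfun_eq`).

The operators separate too. Let D be the one-variable operator (Dg)(u) = (θ₁(u-h) g(u+h) + θ₁(u+h)
g(u-h)) / θ₁(u). Oddness of θ₁ gives M̃₁ = D_u D_v, and on functions g(u)g(v) M̃₂ acts as D_u² +
D_v². Hence it is enough that Dϑ = cϑ with c = θ₁(2h)ϑ(0) / (θ₁(h)ϑ(h)): the eigenvalues are then
c·c and c² + c².

The relation Dϑ = cϑ (`theta1_evenTheta_identity`) becomes elementary algebra once θ₁(x)ϑ(y) is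
written as an antisymmetrization of G(x+y)G(x-y) for a single function G
(`exists_theta1_mul_evenTheta`). -/

/-- The theta function `θ₃(z | 2τ)`. -/
noncomputable def nullTheta (τ z : ℂ) : ℂ := jacobiTheta₂ z (2 * τ)

/-- The theta function `θ₂(z | 2τ)`. -/
noncomputable def halfTheta (τ z : ℂ) : ℂ :=
  cexp (2 * Real.pi * I * (z / 2 + τ / 4)) * jacobiTheta₂ (z + τ) (2 * τ)

/-! ### Parity and translations of the theta functions of modulus 2τ -/

theorem nullTheta_neg (τ z : ℂ) : nullTheta τ (-z) = nullTheta τ z :=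
  jacobiTheta₂_neg_left _ _

theorem nullTheta_add_one (τ z : ℂ) : nullTheta τ (z + 1) = nullTheta τ z :=
  jacobiTheta₂_add_left _ _

theorem nullTheta_add_tau (τ z : ℂ) :
    nullTheta τ (z + τ) = cexp (2 * Real.pi * I * (-z / 2 - τ / 4)) * halfTheta τ z := by
  rw [nullTheta, halfTheta, ← mul_assoc, ← Complex.exp_add]
  ring_nf
  simp

theorem halfTheta_add_tau (τ z : ℂ) :
    halfTheta τ (z + τ) = cexp (2 * Real.pi * I * (-z / 2 - τ / 4)) * nullTheta τ z := by
  rw [nullTheta, halfTheta, show z + τ + τ = z + 2 * τ by ring, jacobiTheta₂_add_left',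
    ← mul_assoc, ← Complex.exp_add]
  ring_nf

theorem halfTheta_neg (τ z : ℂ) : halfTheta τ (-z) = halfTheta τ z := by
  rw [halfTheta, halfTheta, show z + τ = (z - τ) + 2 * τ by ring, jacobiTheta₂_add_left',
    ← jacobiTheta₂_neg_left (z - τ), ← mul_assoc, ← Complex.exp_add]
  ring_nf

theorem halfTheta_add_one (τ z : ℂ) : halfTheta τ (z + 1) = -halfTheta τ z := by
  rw [halfTheta, halfTheta, show z + 1 + τ = (z + τ) + 1 by ring, jacobiTheta₂_add_left,
    show 2 * (Real.pi : ℂ) * I * ((z + 1) / 2 + τ / 4)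
      = 2 * Real.pi * I * (z / 2 + τ / 4) + Real.pi * I by ring, Complex.exp_add, exp_pi_mul_I]
  ring

/-! ### Addition formulas from modulus τ to modulus 2τ -/

/-- The pairs of integers, split by whether the two entries have equal or opposite parity. -/
def parityEquiv : (ℤ × ℤ) ⊕ (ℤ × ℤ) ≃ ℤ × ℤ where
  toFun := Sum.elim (fun p => (p.1 + p.2, p.1 - p.2)) (fun p => (p.1 + p.2 + 1, p.1 - p.2))
  invFun p := if (p.1 + p.2) % 2 = 0 then Sum.inl ((p.1 + p.2) / 2, (p.1 - p.2) / 2)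
    else Sum.inr ((p.1 + p.2) / 2, (p.1 - p.2) / 2)
  left_inv := by
    rintro (⟨k, l⟩ | ⟨k, l⟩)
    · have h : (k + l + (k - l)) % 2 = 0 := by omega
      simp only [Sum.elim_inl, h, if_true, Sum.inl.injEq, Prod.mk.injEq]
      omega
    · have h : ¬ (k + l + 1 + (k - l)) % 2 = 0 := by omega
      simp only [Sum.elim_inr, h, if_false, Sum.inr.injEq, Prod.mk.injEq]
      omega
  right_inv := by
    rintro ⟨m, n⟩
    by_cases h : (m + n) % 2 = 0
    · simp only [h, if_true, Sum.elim_inl, Prod.mk.injEq]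
      omega
    · simp only [h, if_false, Sum.elim_inr, Prod.mk.injEq]
      omega

theorem summable_norm_jacobiTheta₂_term {τ : ℂ} (hτ : 0 < τ.im) (z : ℂ) :
    Summable fun n => ‖jacobiTheta₂_term n z τ‖ :=
  ((summable_jacobiTheta₂_term_iff z τ).mpr hτ).norm

theorem hasSum_jacobiTheta₂_mul {τ τ' : ℂ} (hτ : 0 < τ.im) (hτ' : 0 < τ'.im) (x y : ℂ) :
    HasSum (fun p : ℤ × ℤ => jacobiTheta₂_term p.1 x τ * jacobiTheta₂_term p.2 y τ')
      (jacobiTheta₂ x τ * jacobiTheta₂ y τ') := by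
  have hs := summable_mul_of_summable_norm (f := fun n => jacobiTheta₂_term n x τ)
    (g := fun n => jacobiTheta₂_term n y τ') (summable_norm_jacobiTheta₂_term hτ x)
    (summable_norm_jacobiTheta₂_term hτ' y)
  exact HasSum.mul (f := fun n => jacobiTheta₂_term n x τ)
    (g := fun n => jacobiTheta₂_term n y τ') (hasSum_jacobiTheta₂_term x hτ)
    (hasSum_jacobiTheta₂_term y hτ') hs

theorem two_mul_im_pos {τ : ℂ} (hτ : 0 < τ.im) : 0 < (2 * τ).im := by
  simpa using hτ

/-- Substitute m = k+l, n = k-l in the double sum: then m²+n² = 2(k²+l²) and mx+ny = k(x+y)+l(x-y),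
so both variables separate at modulus 2τ. Pairs of opposite parity shift k and l by 1/2 and give the
`halfTheta` term. -/
theorem jacobiTheta₂_mul {τ : ℂ} (hτ : 0 < τ.im) (x y : ℂ) :
    jacobiTheta₂ x τ * jacobiTheta₂ y τ =
      nullTheta τ (x + y) * nullTheta τ (x - y) + halfTheta τ (x + y) * halfTheta τ (x - y) := by
  have h2 := two_mul_im_pos hτ
  have h := hasSum_jacobiTheta₂_mul hτ hτ x y
  rw [← parityEquiv.hasSum_iff] at h
  refine h.unique (HasSum.sum ?_ ?_)
  · rw [nullTheta, nullTheta]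
    convert hasSum_jacobiTheta₂_mul h2 h2 (x + y) (x - y) using 1
    funext p
    simp only [parityEquiv, Function.comp, Equiv.coe_fn_mk, Sum.elim_inl, jacobiTheta₂_term,
      ← Complex.exp_add]
    congr 1
    push_cast
    ring
  · rw [halfTheta, halfTheta, mul_mul_mul_comm]
    convert ((hasSum_jacobiTheta₂_mul h2 h2 (x + y + τ) (x - y + τ)).mul_left
      (cexp (2 * Real.pi * I * ((x + y) / 2 + τ / 4)) *
        cexp (2 * Real.pi * I * ((x - y) / 2 + τ / 4)))) using 1
    · rfl
    funext p
    simp only [parityEquiv, Function.comp, Equiv.coe_fn_mk, Sum.elim_inr, jacobiTheta₂_term,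
      ← Complex.exp_add]
    congr 1
    push_cast
    ring

theorem theta3_eq (τ z : ℂ) : theta3 τ z = jacobiTheta₂ z τ := by
  refine tsum_congr fun k => ?_
  rw [jacobiTheta₂_term]
  ring_nf

theorem theta4_eq (τ z : ℂ) : theta4 τ z = jacobiTheta₂ (z + 1 / 2) τ := by
  refine tsum_congr fun k => ?_
  rw [jacobiTheta₂_term]
  ring_nf

theorem theta2_eq (τ z : ℂ) : theta2 τ z =
    cexp (2 * Real.pi * I * (z / 2 + τ / 8)) * jacobiTheta₂ (z + τ / 2) τ := by
  rw [jacobiTheta₂, ← tsum_mul_left]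
  refine tsum_congr fun k => ?_
  rw [jacobiTheta₂_term, ← Complex.exp_add]
  ring_nf

theorem theta1_eq (τ z : ℂ) : theta1 τ z = theta2 τ (z + 1 / 2) := rfl

theorem theta3_mul_theta3 {τ : ℂ} (hτ : 0 < τ.im) (x y : ℂ) :
    theta3 τ x * theta3 τ y =
      nullTheta τ (x + y) * nullTheta τ (x - y) + halfTheta τ (x + y) * halfTheta τ (x - y) := by
  rw [theta3_eq, theta3_eq, jacobiTheta₂_mul hτ]

theorem theta4_mul_theta4 {τ : ℂ} (hτ : 0 < τ.im) (x y : ℂ) :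
    theta4 τ x * theta4 τ y =
      nullTheta τ (x + y) * nullTheta τ (x - y) - halfTheta τ (x + y) * halfTheta τ (x - y) := by
  rw [theta4_eq, theta4_eq, jacobiTheta₂_mul hτ,
    show x + 1 / 2 + (y + 1 / 2) = x + y + 1 by ring,
    show x + 1 / 2 - (y + 1 / 2) = x - y by ring, nullTheta_add_one, halfTheta_add_one]
  ring

theorem theta2_mul_theta2 {τ : ℂ} (hτ : 0 < τ.im) (x y : ℂ) :
    theta2 τ x * theta2 τ y =
      halfTheta τ (x + y) * nullTheta τ (x - y) + nullTheta τ (x + y) * halfTheta τ (x - y) := by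
  have h : cexp (2 * Real.pi * I * (x / 2 + τ / 8)) * cexp (2 * Real.pi * I * (y / 2 + τ / 8)) *
      cexp (2 * Real.pi * I * (-(x + y) / 2 - τ / 4)) = 1 := by
    rw [← Complex.exp_add, ← Complex.exp_add, ← Complex.exp_zero]
    ring_nf
  have h' := jacobiTheta₂_mul hτ (x + τ / 2) (y + τ / 2)
  rw [show x + τ / 2 + (y + τ / 2) = x + y + τ by ring,
    show x + τ / 2 - (y + τ / 2) = x - y by ring, nullTheta_add_tau, halfTheta_add_tau] at h'
  rw [theta2_eq, theta2_eq]
  linear_combination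
    cexp (2 * Real.pi * I * (x / 2 + τ / 8)) * cexp (2 * Real.pi * I * (y / 2 + τ / 8)) * h' +
    (halfTheta τ (x + y) * nullTheta τ (x - y) + nullTheta τ (x + y) * halfTheta τ (x - y)) * h

theorem theta1_neg (τ z : ℂ) : theta1 τ (-z) = -theta1 τ z := by
  rw [theta1_eq, theta1_eq, theta2_eq, theta2_eq, ← jacobiTheta₂_neg_left,
    show z + 1 / 2 + τ / 2 = (-(-z + 1 / 2 + τ / 2) + 1) + τ by ring, jacobiTheta₂_add_left',
    jacobiTheta₂_add_left, ← mul_assoc, ← Complex.exp_add]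
  generalize jacobiTheta₂ _ _ = J
  -- Moving the reflected argument by 1 + τ leaves a factor e^{-πi}, which is the sign of an odd
  -- function.
  rw [show 2 * (Real.pi : ℂ) * I * ((z + 1 / 2) / 2 + τ / 8) +
      -Real.pi * I * (τ + 2 * (-(-z + 1 / 2 + τ / 2) + 1)) =
      2 * Real.pi * I * ((-z + 1 / 2) / 2 + τ / 8) - Real.pi * I by ring, Complex.exp_sub,
    exp_pi_mul_I]
  ring

/-! ### The eigenvalue identity in one variable -/

/-- Every product `θ₁(x) θ_j(y)` with `j = 2, 3, 4` is an antisymmetrized product of one function. -/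
theorem exists_theta1_mul_evenTheta {τ : ℂ} (hτ : 0 < τ.im) (i : Fin 3) :
    ∃ (c : ℂ) (G : ℂ → ℂ), ∀ x y, theta1 τ x * evenTheta τ i y =
      c * (G (x + y) * G (x - y) - G (-(x + y)) * G (-(x - y))) := by
  have hA (z : ℂ) : nullTheta τ (-z + 1 / 2) = nullTheta τ (z + 1 / 2) := by
    rw [← nullTheta_neg, ← nullTheta_add_one]
    ring_nf
  have hB (z : ℂ) : halfTheta τ (-z + 1 / 2) = -halfTheta τ (z + 1 / 2) := by
    rw [show z + 1 / 2 = z - 1 / 2 + 1 by ring, halfTheta_add_one, neg_neg, ← halfTheta_neg]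
    ring_nf
  have hC (z : ℂ) : halfTheta τ (z + τ / 2) =
      cexp (2 * Real.pi * I * (-z / 2)) * nullTheta τ (-z + τ / 2) := by
    rw [show z + τ / 2 = z - τ / 2 + τ by ring, halfTheta_add_tau, ← nullTheta_neg]
    ring_nf
  fin_cases i
  -- After the shift by 1/2, `nullTheta` is even and `halfTheta` is odd, so antisymmetrizing their
  -- sum keeps exactly the mixed products, each twice.
  · refine ⟨1 / 2, fun z => nullTheta τ (z + 1 / 2) + halfTheta τ (z + 1 / 2), fun x y => ?_⟩
    simp only [evenTheta, Fin.zero_eta, Matrix.cons_val_zero, hA, hB]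
    rw [theta1_eq, theta2_mul_theta2 hτ, show x + 1 / 2 + y = x + y + 1 / 2 by ring,
      show x + 1 / 2 - y = x - y + 1 / 2 by ring]
    ring
  -- By `hC`, a shift by τ/2 makes `halfTheta` a reflected `nullTheta` up to an exponential; the
  -- factor e^{2πiz/4} in G shares that exponential evenly between the two terms. The minus sign is
  -- the e^{-πi} in `h2`.
  · refine ⟨cexp (2 * Real.pi * I * (1 / 4 + τ / 8)),
      fun z => cexp (2 * Real.pi * I * (z / 4)) * nullTheta τ (z + 1 / 2 + τ / 2), fun x y => ?_⟩
    simp only [evenTheta, Fin.mk_one, Matrix.cons_val_one, Matrix.cons_val_zero]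
    have hD (z : ℂ) : nullTheta τ (-(z + 1 / 2) + τ / 2) = nullTheta τ (-z + 1 / 2 + τ / 2) := by
      rw [← nullTheta_add_one]
      ring_nf
    rw [theta1_eq, theta2_eq, theta3_eq, mul_assoc, jacobiTheta₂_mul hτ,
      show x + 1 / 2 + τ / 2 + y = x + y + 1 / 2 + τ / 2 by ring,
      show x + 1 / 2 + τ / 2 - y = x - y + 1 / 2 + τ / 2 by ring, hC, hC, hD, hD]
    have h1 : cexp (2 * Real.pi * I * ((x + 1 / 2) / 2 + τ / 8)) =
        cexp (2 * Real.pi * I * (1 / 4 + τ / 8)) * cexp (2 * Real.pi * I * ((x + y) / 4)) *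
          cexp (2 * Real.pi * I * ((x - y) / 4)) := by
      rw [← Complex.exp_add, ← Complex.exp_add]
      ring_nf
    have h2 : cexp (2 * Real.pi * I * ((x + 1 / 2) / 2 + τ / 8)) *
        cexp (2 * Real.pi * I * (-(x + y + 1 / 2) / 2)) *
        cexp (2 * Real.pi * I * (-(x - y + 1 / 2) / 2)) =
        -(cexp (2 * Real.pi * I * (1 / 4 + τ / 8)) * cexp (2 * Real.pi * I * (-(x + y) / 4)) *
          cexp (2 * Real.pi * I * (-(x - y) / 4))) := by
      rw [← Complex.exp_add, ← Complex.exp_add, ← Complex.exp_add, ← Complex.exp_add,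
        show ∀ a : ℂ, -cexp a = cexp a * cexp (-(Real.pi * I)) by
          intro a; rw [Complex.exp_neg, exp_pi_mul_I]; norm_num, ← Complex.exp_add]
      ring_nf
    linear_combination
      nullTheta τ (x + y + 1 / 2 + τ / 2) * nullTheta τ (x - y + 1 / 2 + τ / 2) * h1 +
      nullTheta τ (-(x + y) + 1 / 2 + τ / 2) * nullTheta τ (-(x - y) + 1 / 2 + τ / 2) * h2
  -- As in the previous case, except that the minus sign now comes from the antiperiodicity of
  -- `halfTheta`.
  · refine ⟨cexp (2 * Real.pi * I * (1 / 4 + τ / 8)),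
      fun z => cexp (2 * Real.pi * I * (z / 4)) * nullTheta τ (z + τ / 2), fun x y => ?_⟩
    simp only [evenTheta, Fin.reduceFinMk, Matrix.cons_val]
    rw [theta1_eq, theta2_eq, theta4_eq, mul_assoc, jacobiTheta₂_mul hτ,
      show x + 1 / 2 + τ / 2 + (y + 1 / 2) = x + y + τ / 2 + 1 by ring,
      show x + 1 / 2 + τ / 2 - (y + 1 / 2) = x - y + τ / 2 by ring, nullTheta_add_one,
      halfTheta_add_one, hC, hC]
    have h1 : cexp (2 * Real.pi * I * ((x + 1 / 2) / 2 + τ / 8)) =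
        cexp (2 * Real.pi * I * (1 / 4 + τ / 8)) * cexp (2 * Real.pi * I * ((x + y) / 4)) *
          cexp (2 * Real.pi * I * ((x - y) / 4)) := by
      rw [← Complex.exp_add, ← Complex.exp_add]
      ring_nf
    have h2 : cexp (2 * Real.pi * I * ((x + 1 / 2) / 2 + τ / 8)) *
        cexp (2 * Real.pi * I * (-(x + y) / 2)) * cexp (2 * Real.pi * I * (-(x - y) / 2)) =
        cexp (2 * Real.pi * I * (1 / 4 + τ / 8)) * cexp (2 * Real.pi * I * (-(x + y) / 4)) *
          cexp (2 * Real.pi * I * (-(x - y) / 4)) := by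
      rw [← Complex.exp_add, ← Complex.exp_add, ← Complex.exp_add, ← Complex.exp_add]
      ring_nf
    linear_combination
      nullTheta τ (x + y + τ / 2) * nullTheta τ (x - y + τ / 2) * h1 -
      nullTheta τ (-(x + y) + τ / 2) * nullTheta τ (-(x - y) + τ / 2) * h2

/-- With A± = G(±2h) and B± = G(±2u), the bracket is c(A₊+A₋)(B₊-B₋), and both sides equal
c²G(0)(A₊²-A₋²)(B₊-B₋). -/
theorem theta1_evenTheta_identity {τ : ℂ} (hτ : 0 < τ.im) (i : Fin 3) (h u : ℂ) :
    theta1 τ h * evenTheta τ i h *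
        (theta1 τ (u - h) * evenTheta τ i (u + h) + theta1 τ (u + h) * evenTheta τ i (u - h)) =
      theta1 τ (2 * h) * evenTheta τ i 0 * (theta1 τ u * evenTheta τ i u) := by
  obtain ⟨c, G, hG⟩ := exists_theta1_mul_evenTheta hτ i
  rw [hG, hG, hG, hG, hG, show u - h + (u + h) = 2 * u by ring,
    show u + h + (u - h) = 2 * u by ring, show u - h - (u + h) = -(2 * h) by ring,
    show u + h - (u - h) = 2 * h by ring, ← two_mul, ← two_mul, sub_self, sub_self, add_zero,
    sub_zero, neg_neg, neg_zero]
  ring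

/-! ### Factorization of Θ_μ and of the eigenfunctions -/

theorem mem_corootLattice_iff {a : V} :
    a ∈ corootLattice ↔ ∃ m n : ℤ, a = ![2 * (m : ℂ), 2 * (n : ℂ)] := by
  rw [corootLattice, AddSubgroup.mem_closure_pair]
  refine exists_congr fun m => exists_congr fun n => ?_
  rw [eq_comm]
  refine Eq.congr_right ?_
  ext j
  fin_cases j <;> simp [e1, e2, mul_comm]

/-- Coordinates on the coroot lattice. -/
noncomputable def corootEquiv : ℤ × ℤ ≃ corootLattice :=
  Equiv.ofBijective
    (fun p => ⟨![2 * (p.1 : ℂ), 2 * (p.2 : ℂ)], mem_corootLattice_iff.mpr ⟨p.1, p.2, rfl⟩⟩) <| by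
    constructor
    · rintro ⟨m, n⟩ ⟨m', n'⟩ h
      have h0 := congrFun (Subtype.ext_iff.mp h) 0
      have h1 := congrFun (Subtype.ext_iff.mp h) 1
      simpa using And.intro h0 h1
    · rintro ⟨a, ha⟩
      obtain ⟨m, n, rfl⟩ := mem_corootLattice_iff.mp ha
      exact ⟨(m, n), rfl⟩

theorem coe_corootEquiv (p : ℤ × ℤ) :
    (corootEquiv p : V) = ![2 * (p.1 : ℂ), 2 * (p.2 : ℂ)] := rfl

theorem Theta_eq {τ : ℂ} (hτ : 0 < τ.im) (a b : ℂ) (x : V) :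
    Theta τ ![a, b] x =
      (cexp (2 * Real.pi * I * (a * x 0 / 2 + a ^ 2 * τ / 4)) *
          jacobiTheta₂ (x 0 + a * τ) (2 * τ)) *
        (cexp (2 * Real.pi * I * (b * x 1 / 2 + b ^ 2 * τ / 4)) *
          jacobiTheta₂ (x 1 + b * τ) (2 * τ)) := by
  have h2 := two_mul_im_pos hτ
  rw [mul_mul_mul_comm, ← (hasSum_jacobiTheta₂_mul h2 h2 _ _).tsum_eq, ← tsum_mul_left, Theta,
    ← corootEquiv.tsum_eq]
  refine tsum_congr fun p => ?_
  rw [coe_corootEquiv]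
  simp only [form, jacobiTheta₂_term, ← Complex.exp_add, Pi.add_apply, Matrix.cons_val_zero,
    Matrix.cons_val_one]
  congr 1
  ring

theorem Theta_zero {τ : ℂ} (hτ : 0 < τ.im) (x : V) :
    Theta τ 0 x = nullTheta τ (x 0) * nullTheta τ (x 1) := by
  rw [show (0 : V) = ![0, 0] by ext j; fin_cases j <;> rfl, Theta_eq hτ]
  simp [nullTheta]

theorem Theta_e1 {τ : ℂ} (hτ : 0 < τ.im) (x : V) :
    Theta τ e1 x = halfTheta τ (x 0) * nullTheta τ (x 1) := by
  rw [e1, Theta_eq hτ]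
  simp [nullTheta, halfTheta]

theorem Theta_e2 {τ : ℂ} (hτ : 0 < τ.im) (x : V) :
    Theta τ e2 x = nullTheta τ (x 0) * halfTheta τ (x 1) := by
  rw [e2, Theta_eq hτ]
  simp [nullTheta, halfTheta]

theorem Theta_e1_add_e2 {τ : ℂ} (hτ : 0 < τ.im) (x : V) :
    Theta τ (e1 + e2) x = halfTheta τ (x 0) * halfTheta τ (x 1) := by
  rw [show e1 + e2 = ![1, 1] by ext j; fin_cases j <;> simp [e1, e2], Theta_eq hτ]
  simp [halfTheta]

theorem eigenfun_zero {τ : ℂ} (hτ : 0 < τ.im) (x : V) : eigenfun τ 0 x =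
    halfTheta τ (x 0) * nullTheta τ (x 1) + nullTheta τ (x 0) * halfTheta τ (x 1) := by
  simp [eigenfun, Theta_e1 hτ, Theta_e2 hτ]

theorem eigenfun_one {τ : ℂ} (hτ : 0 < τ.im) (x : V) : eigenfun τ 1 x =
    nullTheta τ (x 0) * nullTheta τ (x 1) + halfTheta τ (x 0) * halfTheta τ (x 1) := by
  simp [eigenfun, Theta_zero hτ, Theta_e1_add_e2 hτ]

theorem eigenfun_two {τ : ℂ} (hτ : 0 < τ.im) (x : V) : eigenfun τ 2 x =
    nullTheta τ (x 0) * nullTheta τ (x 1) - halfTheta τ (x 0) * halfTheta τ (x 1) := by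
  simp [eigenfun, Theta_zero hτ, Theta_e1_add_e2 hτ]

/-- In the coordinates `(x, ε₁ ± ε₂)` the three functions separate. -/
theorem eigenfun_eq {τ : ℂ} (hτ : 0 < τ.im) (i : Fin 3) (x : V) :
    eigenfun τ i x = evenTheta τ i ((x 0 + x 1) / 2) * evenTheta τ i ((x 0 - x 1) / 2) := by
  have hs : (x 0 + x 1) / 2 + (x 0 - x 1) / 2 = x 0 := by ring
  have hd : (x 0 + x 1) / 2 - (x 0 - x 1) / 2 = x 1 := by ring
  fin_cases i
  · simp [evenTheta, eigenfun_zero hτ, theta2_mul_theta2 hτ, hs, hd]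
  · simp [evenTheta, eigenfun_one hτ, theta3_mul_theta3 hτ, hs, hd]
  · simp [evenTheta, eigenfun_two hτ, theta4_mul_theta4 hτ, hs, hd]

/-! ### Membership in the Weyl-invariant theta functions -/

theorem differentiable_nullTheta {τ : ℂ} (hτ : 0 < τ.im) : Differentiable ℂ (nullTheta τ) :=
  fun z => differentiableAt_jacobiTheta₂_fst z (two_mul_im_pos hτ)

theorem differentiable_halfTheta {τ : ℂ} (hτ : 0 < τ.im) : Differentiable ℂ (halfTheta τ) := by
  have h := (differentiable_nullTheta hτ).comp (differentiable_id.add_const τ)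
  exact Differentiable.mul (by fun_prop) h

theorem nullTheta_add_two_mul_int (τ z : ℂ) (n : ℤ) :
    nullTheta τ (z + 2 * n) = nullTheta τ z := by
  have h : Function.Periodic (nullTheta τ) 2 := fun z => by
    rw [← one_add_one_eq_two, ← add_assoc, nullTheta_add_one, nullTheta_add_one]
  rw [mul_comm]
  exact h.int_mul n z

theorem halfTheta_add_two_mul_int (τ z : ℂ) (n : ℤ) :
    halfTheta τ (z + 2 * n) = halfTheta τ z := by
  have h : Function.Periodic (halfTheta τ) 2 := fun z => by
    rw [← one_add_one_eq_two, ← add_assoc, halfTheta_add_one, halfTheta_add_one, neg_neg]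
  rw [mul_comm]
  exact h.int_mul n z

theorem quasiperiodic_int {τ : ℂ} {f : ℂ → ℂ}
    (hf : ∀ z, cexp (2 * Real.pi * I * (z + τ)) * f (z + 2 * τ) = f z) (z : ℂ) (n : ℤ) :
    cexp (2 * Real.pi * I * (z * n + n ^ 2 * τ)) * f (z + τ * (2 * n)) = f z := by
  -- The left side does not depend on n, since (n+1)² = n²+2n+1; this one relation serves both
  -- directions of the induction.
  have hstep (n : ℤ) : cexp (2 * Real.pi * I * (z * (n + 1 : ℤ) + (n + 1 : ℤ) ^ 2 * τ)) *
      f (z + τ * (2 * (n + 1 : ℤ))) =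
      cexp (2 * Real.pi * I * (z * n + n ^ 2 * τ)) * f (z + τ * (2 * n)) := by
    rw [← hf (z + τ * (2 * n)), ← mul_assoc (cexp _) (cexp _), ← Complex.exp_add]
    push_cast
    ring_nf
  induction n with
  | zero => simp
  | succ n ih => rw [hstep, ih]
  | pred n ih =>
    rw [← hstep, sub_add_cancel]
    exact ih

theorem nullTheta_quasiperiodic (τ z : ℂ) :
    cexp (2 * Real.pi * I * (z + τ)) * nullTheta τ (z + 2 * τ) = nullTheta τ z := by
  rw [two_mul τ, ← add_assoc, nullTheta_add_tau, halfTheta_add_tau, ← mul_assoc, ← mul_assoc,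
    ← Complex.exp_add, ← Complex.exp_add]
  ring_nf
  simp

theorem halfTheta_quasiperiodic (τ z : ℂ) :
    cexp (2 * Real.pi * I * (z + τ)) * halfTheta τ (z + 2 * τ) = halfTheta τ z := by
  rw [two_mul τ, ← add_assoc, halfTheta_add_tau, nullTheta_add_tau, ← mul_assoc, ← mul_assoc,
    ← Complex.exp_add, ← Complex.exp_add]
  ring_nf
  simp

theorem mul_mem_Th1 {τ : ℂ} {f g : ℂ → ℂ} (hf : Differentiable ℂ f) (hg : Differentiable ℂ g)
    (hf1 : ∀ z (n : ℤ), f (z + 2 * n) = f z) (hg1 : ∀ z (n : ℤ), g (z + 2 * n) = g z)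
    (hfτ : ∀ z, cexp (2 * Real.pi * I * (z + τ)) * f (z + 2 * τ) = f z)
    (hgτ : ∀ z, cexp (2 * Real.pi * I * (z + τ)) * g (z + 2 * τ) = g z) :
    (fun x : V => f (x 0) * g (x 1)) ∈ Th1 τ := by
  refine ⟨?_, fun a ha => ?_⟩
  · exact (hf.comp (differentiable_apply 0)).mul (hg.comp (differentiable_apply 1))
  · obtain ⟨m, n, rfl⟩ := mem_corootLattice_iff.mp ha
    constructor
    · funext x
      have h0 := quasiperiodic_int hfτ (x 0) m
      have h1 := quasiperiodic_int hgτ (x 1) n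
      rw [← h0, ← h1, mul_mul_mul_comm, ← Complex.exp_add]
      simp only [translTau, form, Pi.add_apply, Pi.smul_apply, smul_eq_mul, Matrix.cons_val_zero,
        Matrix.cons_val_one]
      congr 2
      ring
    · funext x
      simp [transl, hf1, hg1]

theorem add_mem_Th1 {τ : ℂ} {f g : V → ℂ} (hf : f ∈ Th1 τ) (hg : g ∈ Th1 τ) :
    (fun x => f x + g x) ∈ Th1 τ := by
  refine ⟨hf.1.add hg.1, fun a ha => ⟨funext fun x => ?_, funext fun x => ?_⟩⟩
  · have h1 := congrFun (hf.2 a ha).1 x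
    have h2 := congrFun (hg.2 a ha).1 x
    simp only [translTau] at h1 h2 ⊢
    rw [mul_add, h1, h2]
  · have h1 := congrFun (hf.2 a ha).2 x
    have h2 := congrFun (hg.2 a ha).2 x
    simp only [transl] at h1 h2 ⊢
    rw [h1, h2]

theorem neg_mem_Th1 {τ : ℂ} {f : V → ℂ} (hf : f ∈ Th1 τ) : (fun x => -f x) ∈ Th1 τ := by
  refine ⟨hf.1.neg, fun a ha => ⟨funext fun x => ?_, funext fun x => ?_⟩⟩
  · have h1 := congrFun (hf.2 a ha).1 x
    simp only [translTau] at h1 ⊢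
    rw [mul_neg, h1]
  · have h1 := congrFun (hf.2 a ha).2 x
    simp only [transl] at h1 ⊢
    rw [h1]

theorem eigenfun_mem_Th1 {τ : ℂ} (hτ : 0 < τ.im) (i : Fin 3) : eigenfun τ i ∈ Th1 τ := by
  have dN := differentiable_nullTheta hτ
  have dH := differentiable_halfTheta hτ
  have pN := nullTheta_add_two_mul_int τ
  have pH := halfTheta_add_two_mul_int τ
  have qN := nullTheta_quasiperiodic τ
  have qH := halfTheta_quasiperiodic τ
  have hNN := mul_mem_Th1 dN dN pN pN qN qN
  have hHH := mul_mem_Th1 dH dH pH pH qH qH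
  fin_cases i
  · refine (funext (eigenfun_zero hτ) : eigenfun τ 0 = _) ▸ ?_
    exact add_mem_Th1 (mul_mem_Th1 dH dN pH pN qH qN) (mul_mem_Th1 dN dH pN pH qN qH)
  · refine (funext (eigenfun_one hτ) : eigenfun τ 1 = _) ▸ ?_
    exact add_mem_Th1 hNN hHH
  · refine (funext (eigenfun_two hτ) : eigenfun τ 2 = _) ▸ ?_
    simp only [sub_eq_add_neg]
    exact add_mem_Th1 hNN (neg_mem_Th1 hHH)

theorem eigenfun_reflection {τ : ℂ} (hτ : 0 < τ.im) (i : Fin 3) {a : V} (ha : a ∈ roots) (x : V) :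
    eigenfun τ i (x - (2 * form x a / form a a) • a) = eigenfun τ i x := by
  have hN := nullTheta_neg τ
  have hH := halfTheta_neg τ
  -- The four reflections of type C₂ in coordinates; opposite roots give the same one.
  have key : ∀ y : V, (y 0 = x 1 ∧ y 1 = x 0) ∨ (y 0 = -x 1 ∧ y 1 = -x 0) ∨
      (y 0 = -x 0 ∧ y 1 = x 1) ∨ (y 0 = x 0 ∧ y 1 = -x 1) →
      eigenfun τ i y = eigenfun τ i x := by
    intro y hy
    fin_cases i
    · change eigenfun τ 0 y = eigenfun τ 0 x
      rw [eigenfun_zero hτ, eigenfun_zero hτ]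
      rcases hy with ⟨h0, h1⟩ | ⟨h0, h1⟩ | ⟨h0, h1⟩ | ⟨h0, h1⟩ <;> rw [h0, h1] <;>
        (try simp only [hN, hH]) <;> ring
    · change eigenfun τ 1 y = eigenfun τ 1 x
      rw [eigenfun_one hτ, eigenfun_one hτ]
      rcases hy with ⟨h0, h1⟩ | ⟨h0, h1⟩ | ⟨h0, h1⟩ | ⟨h0, h1⟩ <;> rw [h0, h1] <;>
        (try simp only [hN, hH]) <;> ring
    · change eigenfun τ 2 y = eigenfun τ 2 x
      rw [eigenfun_two hτ, eigenfun_two hτ]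
      rcases hy with ⟨h0, h1⟩ | ⟨h0, h1⟩ | ⟨h0, h1⟩ | ⟨h0, h1⟩ <;> rw [h0, h1] <;>
        (try simp only [hN, hH]) <;> ring
  apply key
  simp only [roots, Set.mem_insert_iff, Set.mem_singleton_iff] at ha
  rcases ha with rfl | rfl | rfl | rfl | rfl | rfl | rfl | rfl
  · right; left
    constructor <;> simp [form, e1, e2] <;> ring
  · right; left
    constructor <;> simp [form, e1, e2] <;> ring
  · left
    constructor <;> simp [form, e1, e2] <;> ring
  · left
    constructor <;> simp [form, e1, e2] <;> ring
  · right; right; left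
    constructor <;> (simp [form, e1]; try ring)
  · right; right; left
    constructor <;> (simp [form, e1]; try ring)
  · right; right; right
    constructor <;> (simp [form, e2]; try ring)
  · right; right; right
    constructor <;> (simp [form, e2]; try ring)

theorem eigenfun_weylGroup {τ : ℂ} (hτ : 0 < τ.im) (i : Fin 3) {w : V ≃ₗ[ℂ] V}
    (hw : w ∈ weylGroup) : ∀ x : V, eigenfun τ i (w x) = eigenfun τ i x := by
  induction hw using Subgroup.closure_induction with
  | mem s hs =>
    obtain ⟨a, ha, hs⟩ := hs
    intro x
    rw [hs, eigenfun_reflection hτ i ha]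
  | one => exact fun x => rfl
  | mul s t _ _ hs ht => exact fun x => (hs (t x)).trans (ht x)
  | inv s _ hs =>
    intro x
    rw [← hs (s⁻¹ x)]
    exact congrArg _ (s.apply_symm_apply x)

theorem eigenfun_mem_Th1W {τ : ℂ} (hτ : 0 < τ.im) (i : Fin 3) : eigenfun τ i ∈ Th1W τ :=
  ⟨eigenfun_mem_Th1 hτ i, fun _ hw => eigenfun_weylGroup hτ i hw⟩

/-! ### Linear independence -/

/-- The constant Fourier coefficient; it shows that the theta function is not identically zero. -/
theorem integral_jacobiTheta₂ {τ : ℂ} (hτ : 0 < τ.im) :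
    ∫ t : ℝ in 0..1, jacobiTheta₂ t τ = 1 := by
  have hnorm (n : ℤ) (t : ℝ) : ‖jacobiTheta₂_term n t τ‖ = ‖jacobiTheta₂_term n 0 τ‖ := by
    simp [norm_jacobiTheta₂_term]
  have hcont (n : ℤ) : Continuous fun t : ℝ => jacobiTheta₂_term n t τ := by
    unfold jacobiTheta₂_term
    fun_prop
  have hs := intervalIntegral.hasSum_integral_of_dominated_convergence (a := 0) (b := 1)
    (μ := MeasureTheory.volume) (F := fun (n : ℤ) (t : ℝ) => jacobiTheta₂_term n t τ)
    (f := fun t : ℝ => jacobiTheta₂ t τ) (fun n _ => ‖jacobiTheta₂_term n 0 τ‖)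
    (fun n => (hcont n).aestronglyMeasurable)
    (fun n => Filter.Eventually.of_forall fun t _ => (hnorm n t).le)
    (Filter.Eventually.of_forall fun t _ => summable_norm_jacobiTheta₂_term hτ 0)
    intervalIntegrable_const
    (Filter.Eventually.of_forall fun t _ => hasSum_jacobiTheta₂_term t hτ)
  refine hs.unique ?_
  convert hasSum_single (0 : ℤ) fun n hn => ?_ using 1
  · simp [jacobiTheta₂_term]
  · have hn' : 2 * (Real.pi : ℂ) * I * n ≠ 0 :=
      mul_ne_zero two_pi_I_ne_zero (Int.cast_ne_zero.mpr hn)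
    simp only [jacobiTheta₂_term, Complex.exp_add]
    rw [intervalIntegral.integral_mul_const, integral_exp_mul_complex hn', ofReal_one, mul_one,
      mul_comm _ (n : ℂ), exp_int_mul_two_pi_mul_I]
    simp

theorem exists_nullTheta_ne_zero {τ : ℂ} (hτ : 0 < τ.im) : ∃ z, nullTheta τ z ≠ 0 := by
  by_contra! h
  have h1 := integral_jacobiTheta₂ (two_mul_im_pos hτ)
  have h2 (t : ℝ) : jacobiTheta₂ t (2 * τ) = 0 := h t
  simp [h2] at h1

theorem exists_halfTheta_ne_zero {τ : ℂ} (hτ : 0 < τ.im) : ∃ z, halfTheta τ z ≠ 0 := by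
  obtain ⟨z, hz⟩ := exists_nullTheta_ne_zero hτ
  exact ⟨z + τ, by simpa [halfTheta_add_tau] using hz⟩

theorem linearIndependent_eigenfun {τ : ℂ} (hτ : 0 < τ.im) :
    LinearIndependent ℂ (eigenfun τ) := by
  rw [Fintype.linearIndependent_iff]
  intro g hg
  obtain ⟨a, ha⟩ := exists_nullTheta_ne_zero hτ
  obtain ⟨b, hb⟩ := exists_halfTheta_ne_zero hτ
  have key (z w : ℂ) :
      g 0 * (halfTheta τ z * nullTheta τ w + nullTheta τ z * halfTheta τ w) +
      g 1 * (nullTheta τ z * nullTheta τ w + halfTheta τ z * halfTheta τ w) +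
      g 2 * (nullTheta τ z * nullTheta τ w - halfTheta τ z * halfTheta τ w) = 0 := by
    have h := congrFun hg ![z, w]
    simpa [Fin.sum_univ_three, eigenfun_zero hτ, eigenfun_one hτ, eigenfun_two hτ] using h
  -- Translation by 1 fixes `nullTheta` and negates `halfTheta`. Averaging over the four translates
  -- with signs projects onto one type of product, here `nullTheta` times `halfTheta`.
  have h0 : g 0 = 0 := by
    have h1 := key a b
    have h2 := key (a + 1) b
    have h3 := key a (b + 1)
    have h4 := key (a + 1) (b + 1)
    simp only [nullTheta_add_one, halfTheta_add_one] at h1 h2 h3 h4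
    have : g 0 * (nullTheta τ a * halfTheta τ b) = 0 := by
      linear_combination (h1 + h2 - h3 - h4) / 4
    exact (mul_eq_zero.mp this).resolve_right (mul_ne_zero ha hb)
  have hp : g 1 + g 2 = 0 := by
    have h1 := key a a
    have h2 := key (a + 1) a
    have h3 := key a (a + 1)
    have h4 := key (a + 1) (a + 1)
    simp only [nullTheta_add_one, halfTheta_add_one] at h1 h2 h3 h4
    have : (g 1 + g 2) * (nullTheta τ a * nullTheta τ a) = 0 := by
      linear_combination (h1 + h2 + h3 + h4) / 4
    exact (mul_eq_zero.mp this).resolve_right (mul_ne_zero ha ha)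
  have hm : g 1 - g 2 = 0 := by
    have h1 := key b b
    have h2 := key (b + 1) b
    have h3 := key b (b + 1)
    have h4 := key (b + 1) (b + 1)
    simp only [nullTheta_add_one, halfTheta_add_one] at h1 h2 h3 h4
    have : (g 1 - g 2) * (halfTheta τ b * halfTheta τ b) = 0 := by
      linear_combination (h1 - h2 - h3 + h4) / 4
    exact (mul_eq_zero.mp this).resolve_right (mul_ne_zero hb hb)
  intro i
  fin_cases i
  · exact h0
  · change g 1 = 0
    linear_combination (hp + hm) / 2
  · change g 2 = 0
    linear_combination (hp - hm) / 2

/-! ### Action of the difference operators -/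

theorem theta1_evenTheta_step {τ h : ℂ} (hτ : 0 < τ.im) {i : Fin 3} (h1 : theta1 τ h ≠ 0)
    (h2 : evenTheta τ i h ≠ 0) (u : ℂ) :
    theta1 τ (u - h) * evenTheta τ i (u + h) + theta1 τ (u + h) * evenTheta τ i (u - h) =
      theta1 τ (2 * h) * evenTheta τ i 0 / (theta1 τ h * evenTheta τ i h) *
        (theta1 τ u * evenTheta τ i u) := by
  rw [div_mul_eq_mul_div, eq_div_iff (mul_ne_zero h1 h2), mul_comm,
    theta1_evenTheta_identity hτ i h u]

theorem e1_ne_neg_e1 : e1 ≠ -e1 := fun h => by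
  have := congrFun h 0
  norm_num [e1] at this

theorem e2_ne_neg_e2 : e2 ≠ -e2 := fun h => by
  have := congrFun h 1
  norm_num [e2] at this

theorem e1_ne_e2 : e1 ≠ e2 := fun h => by
  have := congrFun h 0
  norm_num [e1, e2] at this

theorem e1_ne_neg_e2 : e1 ≠ -e2 := fun h => by
  have := congrFun h 0
  norm_num [e1, e2] at this

theorem sum_P1 (F : V → ℂ) : ∑ p ∈ P1, F p = F e1 + F (-e1) + F e2 + F (-e2) := by
  rw [P1, Finset.sum_insert, Finset.sum_insert, Finset.sum_insert, Finset.sum_singleton]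
  · ring
  · simpa using e2_ne_neg_e2
  · simpa [neg_eq_iff_eq_neg] using And.intro e1_ne_neg_e2 e1_ne_e2
  · simpa using ⟨e1_ne_neg_e1, e1_ne_e2, e1_ne_neg_e2⟩

theorem prod_P1 (F : V → ℂ) : ∏ p ∈ P1, F p = F e1 * F (-e1) * F e2 * F (-e2) := by
  rw [P1, Finset.prod_insert, Finset.prod_insert, Finset.prod_insert, Finset.prod_singleton]
  · ring
  · simpa using e2_ne_neg_e2
  · simpa [neg_eq_iff_eq_neg] using And.intro e1_ne_neg_e2 e1_ne_e2
  · simpa using ⟨e1_ne_neg_e1, e1_ne_e2, e1_ne_neg_e2⟩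

theorem M1_eq (τ h : ℂ) (f : V → ℂ) (x : V) : M1 τ h f x =
    theta1 τ (form x (e1 + e2) - h) / theta1 τ (form x (e1 + e2)) *
        (theta1 τ (form x (e1 - e2) - h) / theta1 τ (form x (e1 - e2))) *
          f (x + h • (2 : ℂ) • e1) +
      theta1 τ (form x (-e1 + e2) - h) / theta1 τ (form x (-e1 + e2)) *
        (theta1 τ (form x (-e1 - e2) - h) / theta1 τ (form x (-e1 - e2))) *
          f (x + h • (2 : ℂ) • -e1) +
      theta1 τ (form x (e2 + e1) - h) / theta1 τ (form x (e2 + e1)) *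
        (theta1 τ (form x (e2 - e1) - h) / theta1 τ (form x (e2 - e1))) *
          f (x + h • (2 : ℂ) • e2) +
      theta1 τ (form x (-e2 + e1) - h) / theta1 τ (form x (-e2 + e1)) *
        (theta1 τ (form x (-e2 - e1) - h) / theta1 τ (form x (-e2 - e1))) *
          f (x + h • (2 : ℂ) • -e2) := by
  have a := e1_ne_neg_e1
  have b := e2_ne_neg_e2
  have c := e1_ne_e2
  have d := e1_ne_neg_e2
  have d' : -e1 ≠ e2 := fun h => d (neg_eq_iff_eq_neg.mp h)
  simp only [M1, sum_P1, Finset.prod_filter, prod_P1, transl]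
  simp [a, b, c, d, d', a.symm, b.symm, c.symm, d.symm, d'.symm, sub_eq_add_neg]

theorem M1_eigenfun {τ h : ℂ} (hτ : 0 < τ.im) {i : Fin 3} (h1 : theta1 τ h ≠ 0)
    (h2 : evenTheta τ i h ≠ 0) {x : V} (hx : x ∈ regular1 τ) :
    M1 τ h (eigenfun τ i) x = eigenval1 τ h i * eigenfun τ i x := by
  -- These two denominators suffice: the others agree with them up to sign.
  have hu := hx e1 (by simp [P1]) e2 (by simp [P1]) e1_ne_e2.symm
    (fun h => e1_ne_neg_e2 (neg_eq_iff_eq_neg.mpr h |>.symm ▸ by simp))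
  have hv := hx e1 (by simp [P1]) (-e2) (by simp [P1]) e1_ne_neg_e2.symm
    (fun h => e1_ne_e2 (neg_injective h).symm)
  have su := theta1_evenTheta_step hτ h1 h2 ((x 0 + x 1) / 2)
  have sv := theta1_evenTheta_step hτ h1 h2 ((x 0 - x 1) / 2)
  rw [show form x (e1 + e2) = (x 0 + x 1) / 2 by simp [form, e1, e2]] at hu
  rw [show form x (e1 + -e2) = (x 0 - x 1) / 2 by simp [form, e1, e2, sub_eq_add_neg]] at hv
  rw [M1_eq, eigenval1]
  simp only [eigenfun_eq hτ]
  set u := (x 0 + x 1) / 2 with hu'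
  set v := (x 0 - x 1) / 2 with hv'
  have f1 : form x (e1 + e2) = u := by simp [form, e1, e2, u]
  have f2 : form x (e1 - e2) = v := by simp [form, e1, e2, v, sub_eq_add_neg]
  have f3 : form x (-e1 + e2) = -v := by simp [form, e1, e2, v]; ring
  have f4 : form x (-e1 - e2) = -u := by simp [form, e1, e2, u]; ring
  have f5 : form x (e2 - e1) = -v := by simp [form, e1, e2, v]; ring
  have f6 : form x (-e2 - e1) = -u := by simp [form, e1, e2, u]; ring
  rw [add_comm e2 e1, add_comm (-e2) e1, ← sub_eq_add_neg, f1, f2, f3, f4, f5, f6]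
  simp only [Pi.add_apply, Pi.smul_apply, Pi.neg_apply, smul_eq_mul, e1, e2,
    Matrix.cons_val_zero, Matrix.cons_val_one]
  rw [show (x 0 + h * (2 * 1) + (x 1 + h * (2 * 0))) / 2 = u + h by rw [hu']; ring,
    show (x 0 + h * (2 * 1) - (x 1 + h * (2 * 0))) / 2 = v + h by rw [hv']; ring,
    show (x 0 + h * (2 * -1) + (x 1 + h * (2 * -0))) / 2 = u - h by rw [hu']; ring,
    show (x 0 + h * (2 * -1) - (x 1 + h * (2 * -0))) / 2 = v - h by rw [hv']; ring,
    show (x 0 + h * (2 * 0) + (x 1 + h * (2 * 1))) / 2 = u + h by rw [hu']; ring,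
    show (x 0 + h * (2 * 0) - (x 1 + h * (2 * 1))) / 2 = v - h by rw [hv']; ring,
    show (x 0 + h * (2 * -0) + (x 1 + h * (2 * -1))) / 2 = u - h by rw [hu']; ring,
    show (x 0 + h * (2 * -0) - (x 1 + h * (2 * -1))) / 2 = v + h by rw [hv']; ring,
    ← neg_add', ← neg_add']
  simp only [theta1_neg, neg_div_neg_eq]
  clear_value u v
  generalize theta1 τ (2 * h) * evenTheta τ i 0 / (theta1 τ h * evenTheta τ i h) = c at su sv ⊢
  generalize theta1 τ (u - h) = a1 at su ⊢
  generalize theta1 τ (u + h) = a2 at su ⊢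
  generalize theta1 τ (v - h) = b1 at sv ⊢
  generalize theta1 τ (v + h) = b2 at sv ⊢
  field_simp
  -- The cleared left side is the product of the left sides of `su` and `sv`, rewritten one factor
  -- at a time.
  linear_combination (b1 * evenTheta τ i (v + h) + b2 * evenTheta τ i (v - h)) * su +
    c * theta1 τ u * evenTheta τ i u * sv

/-- The one-variable identity behind the action of `M̃₂`. -/
theorem theta1_evenTheta_two_step {τ h : ℂ} (hτ : 0 < τ.im) {i : Fin 3} (h1 : theta1 τ h ≠ 0)
    (h2 : evenTheta τ i h ≠ 0) {u : ℂ} (hu : theta1 τ u ≠ 0) (hp : theta1 τ (u + h) ≠ 0)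
    (hm : theta1 τ (u - h) ≠ 0) :
    theta1 τ (u - h) / theta1 τ (u + h) * evenTheta τ i (u + 2 * h) +
        theta1 τ (u - h) * theta1 τ (u + 2 * h) / (theta1 τ u * theta1 τ (u + h)) *
          evenTheta τ i u +
      (theta1 τ (u + h) / theta1 τ (u - h) * evenTheta τ i (u - 2 * h) +
        theta1 τ (u + h) * theta1 τ (u - 2 * h) / (theta1 τ u * theta1 τ (u - h)) *
          evenTheta τ i u) = eigenval1 τ h i * evenTheta τ i u := by
  have s0 := theta1_evenTheta_step hτ h1 h2 u
  have sp := theta1_evenTheta_step hτ h1 h2 (u + h)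
  have sm := theta1_evenTheta_step hτ h1 h2 (u - h)
  rw [add_sub_cancel_right, add_assoc, ← two_mul] at sp
  rw [sub_add_cancel, sub_sub, ← two_mul] at sm
  rw [eigenval1]
  generalize theta1 τ (2 * h) * evenTheta τ i 0 / (theta1 τ h * evenTheta τ i h) = c
    at s0 sp sm ⊢
  generalize theta1 τ (u - h) = a1 at *
  generalize theta1 τ (u + h) = a2 at *
  field_simp
  -- This is D²ϑ = c²ϑ multiplied by θ₁(u)θ₁(u+h)θ₁(u-h): the inner D is applied at u ± h, the outer
  -- one at u.
  linear_combination a1 ^ 2 * sp + a2 ^ 2 * sm + c * a1 * a2 * s0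

theorem M2_eigenfun {τ h : ℂ} (hτ : 0 < τ.im) {i : Fin 3} (h1 : theta1 τ h ≠ 0)
    (h2 : evenTheta τ i h ≠ 0) {x : V} (hx : x ∈ regular2 τ h) :
    M2 τ h (eigenfun τ i) x = eigenval2 τ h i * eigenfun τ i x := by
  have r1 := hx e1 (by simp) e2 (by simp)
  have r2 := hx e1 (by simp) (-e2) (by simp)
  have r3 := hx (-e1) (by simp) e2 (by simp)
  have r4 := hx (-e1) (by simp) (-e2) (by simp)
  rw [M2, Finset.sum_pair e1_ne_neg_e1, Finset.sum_pair e2_ne_neg_e2,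
    Finset.sum_pair e2_ne_neg_e2, eigenval2]
  simp only [transl, eigenfun_eq hτ]
  set u := (x 0 + x 1) / 2 with hu'
  set v := (x 0 - x 1) / 2 with hv'
  have f1 : form x (e1 + e2) = u := by simp [form, e1, e2, u]
  have f2 : form x (e1 + -e2) = v := by simp [form, e1, e2, v, sub_eq_add_neg]
  have f3 : form x (-e1 + e2) = -v := by simp [form, e1, e2, v]; ring
  have f4 : form x (-e1 + -e2) = -u := by simp [form, e1, e2, u]; ring
  rw [f1] at r1 ⊢
  rw [f2] at r2 ⊢
  rw [f3] at r3 ⊢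
  rw [f4] at r4 ⊢
  -- Oddness turns the conditions at the negative weights into θ₁(u-h) ≠ 0 and θ₁(v-h) ≠ 0.
  rw [show -u + h = -(u - h) by ring, theta1_neg, neg_ne_zero, theta1_neg, neg_ne_zero] at r4
  rw [show -v + h = -(v - h) by ring, theta1_neg, neg_ne_zero, theta1_neg, neg_ne_zero] at r3
  simp only [Pi.add_apply, Pi.smul_apply, Pi.neg_apply, smul_eq_mul, e1, e2,
    Matrix.cons_val_zero, Matrix.cons_val_one]
  rw [show (x 0 + h * (2 * 1) + h * (2 * 0) + (x 1 + h * (2 * 0) + h * (2 * 1))) / 2 = u + 2 * h by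
      rw [hu']; ring,
    show (x 0 + h * (2 * 1) + h * (2 * 0) - (x 1 + h * (2 * 0) + h * (2 * 1))) / 2 = v by
      rw [hv']; ring,
    show (x 0 + h * (2 * 1) + h * (2 * -0) + (x 1 + h * (2 * 0) + h * (2 * -1))) / 2 = u by
      rw [hu']; ring,
    show (x 0 + h * (2 * 1) + h * (2 * -0) - (x 1 + h * (2 * 0) + h * (2 * -1))) / 2 = v + 2 * h by
      rw [hv']; ring,
    show (x 0 + h * (2 * -1) + h * (2 * 0) + (x 1 + h * (2 * -0) + h * (2 * 1))) / 2 = u by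
      rw [hu']; ring,
    show (x 0 + h * (2 * -1) + h * (2 * 0) - (x 1 + h * (2 * -0) + h * (2 * 1))) / 2 = v - 2 * h by
      rw [hv']; ring,
    show (x 0 + h * (2 * -1) + h * (2 * -0) + (x 1 + h * (2 * -0) + h * (2 * -1))) / 2 =
      u - 2 * h by rw [hu']; ring,
    show (x 0 + h * (2 * -1) + h * (2 * -0) - (x 1 + h * (2 * -0) + h * (2 * -1))) / 2 = v by
      rw [hv']; ring,
    show -u - h = -(u + h) by ring, show -u + h = -(u - h) by ring,
    show -u + 2 * h = -(u - 2 * h) by ring, show -v - h = -(v + h) by ring,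
    show -v + h = -(v - h) by ring, show -v + 2 * h = -(v - 2 * h) by ring]
  simp only [theta1_neg, neg_div_neg_eq, neg_mul_neg]
  have su := theta1_evenTheta_two_step hτ h1 h2 r1.1 r1.2 r4.2
  have sv := theta1_evenTheta_two_step hτ h1 h2 r2.1 r2.2 r3.2
  linear_combination evenTheta τ i v * su + evenTheta τ i u * sv

end C2

theorem theorem3 (τ : ℂ) (hτ : 0 < τ.im) (h : ℂ) :
    (∀ i : Fin 3, C2.eigenfun τ i ∈ C2.Th1W τ) ∧
    LinearIndependent ℂ (C2.eigenfun τ) ∧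
    ∀ i : Fin 3,
      C2.eigenfun τ i ≠ 0 ∧
      (C2.theta1 τ h ≠ 0 → C2.evenTheta τ i h ≠ 0 →
        (∀ x ∈ C2.regular1 τ,
          C2.M1 τ h (C2.eigenfun τ i) x = C2.eigenval1 τ h i * C2.eigenfun τ i x) ∧
        (∀ x ∈ C2.regular2 τ h,
          C2.M2 τ h (C2.eigenfun τ i) x = C2.eigenval2 τ h i * C2.eigenfun τ i x)) := by
  have hli := C2.linearIndependent_eigenfun hτ
  exact ⟨C2.eigenfun_mem_Th1W hτ, hli, fun i => ⟨hli.ne_zero i, fun h1 h2 =>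
    ⟨fun _ hx => C2.M1_eigenfun hτ h1 h2 hx, fun _ hx => C2.M2_eigenfun hτ h1 h2 hx⟩⟩⟩
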